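/- Let $0<\alpha<1$ and $a(t)=t^\alpha$, and consider the two-dimensional Robertson-Walker spacetime $\{(t,\chi): t>0,\ \chi\in\mathbb R\}$ with metric $ds^2=-dt^2+a(t)^2\,d\chi^2$ in curvature-normalized coordinates $(t,\chi)$, with central observer $\beta(\tau)=(\tau,0)$. For $\tau>0$ the event with Fermi coordinates $(\tau,\rho)$ is $\exp_{\beta(\tau)}\!\big(\tfrac{\rho}{a(\tau)}\,\partial_\chi\big)$, i.e. the event at proper distance $\rho$ along the spacelike geodesic that leaves $\beta$ orthogonally at $\beta(\tau)$ in the direction of increasing $\chi$, whenever that geodesic reaches distance $\rho$ inside the spacetime. Put $$C_\alpha=\frac{\sqrt\pi\,\Gamma\!\big(\frac{1+\alpha}{2\alpha}\big)}{\Gamma\!\big(\frac1{2\alpha}\big)},\qquad F_\alpha(z)=z^{\frac{1-\alpha}{\alpha}}\,{}_2F_1\!\Big(\tfrac12,\tfrac{1-\alpha}{2\alpha};\tfrac{1+\alpha}{2\alpha};z^2\Big)\quad(0<z<1),$$ $$G_\alpha(v)=\Big(F_\alpha^{-1}\big(C_\alpha-\tfrac{1-\alpha}{\alpha}v\big)\Big)^{1/\alpha}\quad\Big(0<v<\tfrac{\alpha}{1-\alpha}C_\alpha\Big).$$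 Let $\tau>0$ and $\rho>0$. An event with Fermi coordinates $(\tau,\rho)$ exists if and only if $\rho<C_\alpha\tau$. In that case the change from Fermi to curvature-normalized coordinates is differentiable at $(\tau,\rho)$; there is a unique $\chi$ such that, with $v=v(\tau,\chi)=\alpha\chi/\tau^{1-\alpha}$, the event with Fermi coordinates $(\tau,\rho)$ is the event $(G_\alpha(v)\tau,\chi)$ in curvature-normalized coordinates; for this $\chi$ one has $0<v<\frac{\alpha}{1-\alpha}C_\alpha$; and at $(\tau,\rho)$ the metric in Fermi coordinates is $ds^2=g_{\tau\tau}\,d\tau^2+d\rho^2$ with $$g_{\tau\tau}(\tau,\rho)=-\Big(G_\alpha^{1-\alpha}(v)+\frac{1-\alpha}{\alpha}\sqrt{1-G_\alpha^{2\alpha}(v)}\;v\Big)^2 .$$ -/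

import Mathlib

noncomputable section

namespace Fermi

/-- Points and coordinate vectors of a two-dimensional coordinate domain. -/
abbrev Vec : Type := Fin 2 → ℝ

/-! Coordinate (pseudo-)Riemannian geometry in dimension two. -/

/-- The partial derivative `∂_l g_{jk}` at `x`. -/
def metricDeriv (g : Vec → Matrix (Fin 2) (Fin 2) ℝ) (x : Vec) (l j k : Fin 2) : ℝ :=
  fderiv ℝ (fun y => g y j k) x (Pi.single l 1)

/-- The Christoffel symbol `Γ^i_{jk}` of the Levi-Civita connection of `g` at `x`. -/
def christoffel (g : Vec → Matrix (Fin 2) (Fin 2) ℝ) (x : Vec) (i j k : Fin 2) : ℝ :=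
  (1 / 2) * ∑ l, (g x)⁻¹ i l *
    (metricDeriv g x j l k + metricDeriv g x k l j - metricDeriv g x l j k)

/-- `γ`, with velocity `w`, is an affinely parametrized geodesic of `g` inside `M` on the set `I`
of parameters. -/
structure IsGeodesicOn (g : Vec → Matrix (Fin 2) (Fin 2) ℝ) (M : Set Vec)
    (γ w : ℝ → Vec) (I : Set ℝ) : Prop where
  mem : ∀ s ∈ I, γ s ∈ M
  hasDerivAt_pos : ∀ s ∈ I, HasDerivAt γ (w s) s
  hasDerivAt_vel : ∀ s ∈ I, HasDerivAt w
    (fun i => -∑ j, ∑ k, christoffel g (γ s) i j k * w s j * w s k) s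

/-- `q = exp_p v`: some geodesic of `(M, g)`, defined on an open interval around `[0, 1]`, starts at
`p` with velocity `v` and is at `q` at parameter `1`. -/
def IsExp (g : Vec → Matrix (Fin 2) (Fin 2) ℝ) (M : Set Vec) (p v q : Vec) : Prop :=
  ∃ (γ w : ℝ → Vec) (ε : ℝ), 0 < ε ∧ IsGeodesicOn g M γ w (Set.Ioo (-ε) (1 + ε)) ∧
    γ 0 = p ∧ w 0 = v ∧ γ 1 = q

open Classical in
/-- The exponential map of `(M, g)` (with value `p` where it is not defined). -/
def expMap (g : Vec → Matrix (Fin 2) (Fin 2) ℝ) (M : Set Vec) (p v : Vec) : Vec :=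
  if h : ∃ q, IsExp g M p v q then h.choose else p

/-- The matrix of the pullback of `g` by `Φ`, i.e. of the metric in the coordinates in which `Φ` is
the parametrization. -/
def pullback (g : Vec → Matrix (Fin 2) (Fin 2) ℝ) (Φ : Vec → Vec) (y : Vec) :
    Matrix (Fin 2) (Fin 2) ℝ :=
  Matrix.of fun i j =>
    dotProduct (fderiv ℝ Φ y (Pi.single i 1))
      ((g (Φ y)).mulVec (fderiv ℝ Φ y (Pi.single j 1)))

/-! Robertson-Walker spacetime in curvature-normalized coordinates `(t, χ)`. -/

/-- The set of events: positive coordinate time. -/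
def spacetime : Set Vec := {x | 0 < x 0}

/-- The line element `-dt² + a(t)² dχ²`. -/
def rwMetric (a : ℝ → ℝ) (x : Vec) : Matrix (Fin 2) (Fin 2) ℝ :=
  !![-1, 0; 0, a (x 0) ^ 2]

/-- The event `(τ, 0)` of the central observer at proper time `τ`. -/
def observer (τ : ℝ) : Vec := ![τ, 0]

/-- The unit vector `(1 / a(τ)) ∂/∂χ` at `(τ, 0)`, orthogonal to the observer's 4-velocity
`∂/∂t`. -/
def outward (a : ℝ → ℝ) (τ : ℝ) : Vec := ![0, 1 / a τ]

/-- The pairs `(τ, ρ)` that are Fermi coordinates of an event: the spacelike geodesic which leaves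
the observer's world line orthogonally at proper time `τ` extends, inside the spacetime, to
(signed) proper distance `ρ`. -/
def fermiDomain (a : ℝ → ℝ) : Set Vec :=
  {y | 0 < y 0 ∧ ∃ q, IsExp (rwMetric a) spacetime (observer (y 0)) (y 1 • outward a (y 0)) q}

/-- The event with Fermi coordinates `(τ, ρ)`, expressed in curvature-normalized coordinates. -/
def fermiMap (a : ℝ → ℝ) (y : Vec) : Vec :=
  expMap (rwMetric a) spacetime (observer (y 0)) (y 1 • outward a (y 0))

/-- The matrix `!![g_ττ, g_τρ; g_ρτ, g_ρρ]` of the Robertson-Walker metric in Fermi coordinates. -/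
def fermiMetric (a : ℝ → ℝ) (y : Vec) : Matrix (Fin 2) (Fin 2) ℝ :=
  pullback (rwMetric a) (fermiMap a) y

/-! The special functions for the scale factor `t ^ α`. -/

/-- `C_α = √π Γ((1+α)/(2α)) / Γ(1/(2α))`. -/
def Cα (α : ℝ) : ℝ :=
  Real.sqrt Real.pi * Real.Gamma ((1 + α) / (2 * α)) / Real.Gamma (1 / (2 * α))

/-- `F_α(z) = z^((1-α)/α) ₂F₁(1/2, (1-α)/(2α); (1+α)/(2α); z²)`, for `0 < z < 1`. -/
def Fα (α z : ℝ) : ℝ :=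
  z ^ ((1 - α) / α) *
    ordinaryHypergeometric (1 / 2 : ℝ) ((1 - α) / (2 * α)) ((1 + α) / (2 * α)) (z ^ 2)

/-- `G_α(v) = (F_α⁻¹(C_α - ((1-α)/α) v))^(1/α)`, where `F_α⁻¹` is the inverse of `F_α` on `(0, 1)`. -/
def Gα (α v : ℝ) : ℝ :=
  (Function.invFunOn (Fα α) (Set.Ioo 0 1) (Cα α - (1 - α) / α * v)) ^ (1 / α)

/-- The Hubble speed `v(τ, χ) = α χ / τ^(1-α)`. -/
def hubbleSpeed (α τ χ : ℝ) : ℝ := α * χ / τ ^ (1 - α)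

end Fermi

end

namespace Fermi

open Set Filter Topology

/-! Along a geodesic leaving the observer orthogonally, the momentum a(t)²χ' (the metric does not
depend on χ) and the norm a(t)²χ'² − t'² are conserved. Together they say that the angle θ with tan
θ = −t'/ρ satisfies cos θ = (t/τ)^α. In terms of θ everything is explicit: r = ρ/τ is the integral
`arcLength α θ`, and (1−α)χ/τ^(1−α) = r − (t/τ) tan θ. The singularity t = 0 corresponds to θ = π/2,
at distance C_α τ by a Beta integral; this gives the domain (`isExp_fermiFormula` for existence,
`isExp_unique` for the converse).

By `Fα_cos`, F_α(cos θ) = C_α − r + (t/τ) tan θ. The formula for χ therefore reads F_α((t/τ)^α) =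
C_α − ((1−α)/α) v, that is, t = G_α(v) τ (`Gα_eq`).

The chart is thus (τ, ρ) ↦ (τ f(r), τ^(1−α) h(r)). Differentiating it (`hasFDerivAt_fermiFormula`)
reduces the metric to identities in sin θ and cos θ. -/

/-! ### Hypergeometric series and the derivative of F_α -/

/-- Both sides are (b)_{n+1}. This collapses the coefficients of ₂F₁(a, b; b+1; ·) to binomial ones.
-/
lemma ascPochhammer_eval_mul_shift (b : ℝ) (n : ℕ) :
    (ascPochhammer ℝ n).eval b * (b + n) = b * (ascPochhammer ℝ n).eval (b + 1) := by
  rw [← ascPochhammer_succ_eval, ascPochhammer_succ_left]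
  simp [Polynomial.eval_comp]

lemma ringChoose_eq_ascPochhammer (a : ℝ) (n : ℕ) :
    Ring.choose (a + n - 1) n = (n.factorial : ℝ)⁻¹ * (ascPochhammer ℝ n).eval a := by
  rw [← Ring.multichoose_eq]
  have h := Ring.factorial_nsmul_multichoose_eq_ascPochhammer a n
  rw [Polynomial.ascPochhammer_smeval_eq_eval, nsmul_eq_mul] at h
  rw [← h]
  have : (n.factorial : ℝ) ≠ 0 := by exact_mod_cast n.factorial_ne_zero
  field_simp

lemma ordinaryHypergeometric_hasFPowerSeriesOnBall {a b c : ℝ} (ha : 0 < a) (hb : 0 < b)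
    (hc : 0 < c) :
    HasFPowerSeriesOnBall (ordinaryHypergeometric a b c : ℝ → ℝ)
      (ordinaryHypergeometricSeries ℝ a b c) 0 1 := by
  have hr : (ordinaryHypergeometricSeries ℝ a b c).radius = 1 := by
    apply ordinaryHypergeometricSeries_radius_eq_one
    intro k
    have : (0 : ℝ) ≤ k := k.cast_nonneg
    exact ⟨by linarith, by linarith, by linarith⟩
  rw [← hr]
  exact FormalMultilinearSeries.hasFPowerSeriesOnBall _ (by rw [hr]; exact one_pos)

/-- The first-order differential equation of `₂F₁(a, b; b + 1; ·)`. -/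
lemma ordinaryHypergeometric_hasDerivAt {a b x : ℝ} (ha : 0 < a) (hb : 0 < b) (hx : |x| < 1) :
    ∃ d : ℝ, HasDerivAt (ordinaryHypergeometric a b (b + 1) : ℝ → ℝ) d x ∧
      x * d + b * ordinaryHypergeometric a b (b + 1) x = b * (1 / (1 - x) ^ a) := by
  have hF := ordinaryHypergeometric_hasFPowerSeriesOnBall ha hb (c := b + 1) (by linarith)
  have hxm : x ∈ Metric.eball (0 : ℝ) 1 := by
    simpa [enorm_eq_nnnorm, ← NNReal.coe_lt_coe] using hx
  have hd : DifferentiableAt ℝ (ordinaryHypergeometric a b (b + 1) : ℝ → ℝ) x :=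
    (hF.analyticAt_of_mem hxm).differentiableAt
  refine ⟨_, hd.hasDerivAt, ?_⟩
  have h1 := (hF.fderiv.hasSum hxm).mapL (ContinuousLinearMap.apply ℝ ℝ x)
  have h2 := (hF.hasSum hxm).mul_left b
  have h3 := ((Real.one_div_one_sub_rpow_hasFPowerSeriesOnBall_zero a).hasSum hxm).mul_left b
  simp only [zero_add, ContinuousLinearMap.apply_apply,
    FormalMultilinearSeries.derivSeries_apply_diag] at h1 h2 h3
  -- The Euler operator x d/dx multiplies the n-th term by n; the n = 0 term vanishes, which
  -- accounts for the index shift.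
  have h1' : HasSum (fun n : ℕ => (n : ℝ) * (ordinaryHypergeometricSeries ℝ a b (b + 1) n
      fun _ => x)) (x * deriv (ordinaryHypergeometric a b (b + 1) : ℝ → ℝ) x) := by
    rw [← hasSum_nat_add_iff' 1]
    simpa [fderiv_eq_smul_deriv, mul_comm] using! h1
  refine (h1'.add h2).unique ?_
  convert! h3 using 2 with n
  simp only [ordinaryHypergeometricSeries_apply_eq, FormalMultilinearSeries.ofScalars_apply_eq,
    ringChoose_eq_ascPochhammer, smul_eq_mul]
  have hs := ascPochhammer_eval_mul_shift b n
  have hp : (ascPochhammer ℝ n).eval (b + 1) ≠ 0 := (ascPochhammer_pos n _ (by linarith)).ne'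
  field_simp
  linear_combination (x ^ n * (ascPochhammer ℝ n).eval a) * hs

variable {α : ℝ}

/-- With b = (1−α)/(2α) the third parameter is b + 1 and the prefactor is z^(2b), an integrating
factor for the first-order equation of ₂F₁. -/
lemma hasDerivAt_Fα (h0 : 0 < α) (h1 : α < 1) {z : ℝ} (hz0 : 0 < z) (hz1 : z < 1) :
    HasDerivAt (Fα α) ((1 - α) / α * z ^ (1 / α - 2) / Real.sqrt (1 - z ^ 2)) z := by
  have hb : 0 < (1 - α) / (2 * α) := div_pos (by linarith) (by linarith)
  have hb1 : (1 + α) / (2 * α) = (1 - α) / (2 * α) + 1 := by field_simp; ring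
  have hz2 : |z ^ 2| < 1 := by
    rw [abs_of_nonneg (by positivity)]; nlinarith
  obtain ⟨d, hd, he⟩ := ordinaryHypergeometric_hasDerivAt (a := 1 / 2) (by norm_num) hb hz2
  have hp : HasDerivAt (fun z : ℝ => z ^ 2) (2 * z) z := by simpa using hasDerivAt_pow 2 z
  have := (Real.hasDerivAt_rpow_const (p := (1 - α) / α) (Or.inl hz0.ne')).mul (HasDerivAt.comp (h₂ := ordinaryHypergeometric _ _ _) (h := fun z : ℝ => z ^ 2) z hd hp)
  unfold Fα
  rw [hb1]
  refine this.congr_deriv ?_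
  have e1 : z ^ ((1 - α) / α) = z ^ (1 / α - 2) * z := by
    rw [← Real.rpow_add_one hz0.ne']; congr 1; field_simp; ring
  have e2 : z ^ ((1 - α) / α - 1) = z ^ (1 / α - 2) := by
    congr 1; field_simp; ring
  rw [← Real.sqrt_eq_rpow] at he
  simp only [Function.comp]
  rw [e1, e2]
  have e3 : (1 - α) / α = 2 * ((1 - α) / (2 * α)) := by field_simp
  rw [e3]
  linear_combination 2 * z ^ (1 / α - 2) * he

lemma tendsto_Fα_zero (h0 : 0 < α) (h1 : α < 1) : Tendsto (Fα α) (𝓝 0) (𝓝 0) := by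
  have hb : 0 < (1 - α) / (2 * α) := div_pos (by linarith) (by linarith)
  have hF := ordinaryHypergeometric_hasFPowerSeriesOnBall (a := 1 / 2) (by norm_num) hb
    (c := (1 + α) / (2 * α)) (div_pos (by linarith) (by linarith))
  have hc : ContinuousAt (Fα α) 0 := by
    refine ContinuousAt.mul
      (Real.continuousAt_rpow_const _ _ (Or.inr (div_pos (by linarith) h0).le)) ?_
    refine ContinuousAt.comp (g := ordinaryHypergeometric _ _ _) (f := fun z : ℝ => z ^ 2) ?_
      (by fun_prop)
    simpa using hF.continuousOn.continuousAt (Metric.eball_mem_nhds 0 one_pos)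
  have he : Fα α 0 = 0 := by
    simp [Fα, Real.zero_rpow (div_pos (sub_pos.2 h1) h0).ne']
  simpa [he] using hc.tendsto

/-! ### Arc length and the constant C_α -/

/-- Proper distance, in units of the proper time `τ` of the observer, reached by the orthogonal
spacelike geodesic where the coordinate time has fallen to `τ cos(θ)^(1/α)`. -/
noncomputable def arcLength (α θ : ℝ) : ℝ := ∫ x in (0 : ℝ)..θ, Real.cos x ^ (1 / α) / α

lemma hasDerivAt_arcLength (h0 : 0 < α) (θ : ℝ) :
    HasDerivAt (arcLength α) (Real.cos θ ^ (1 / α) / α) θ := by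
  have hc : Continuous fun x : ℝ => Real.cos x ^ (1 / α) / α :=
    (Real.continuous_cos.rpow_const fun _ => Or.inr (by positivity)).div_const _
  exact intervalIntegral.integral_hasDerivAt_right (hc.intervalIntegrable _ _)
    hc.aestronglyMeasurable.stronglyMeasurableAtFilter hc.continuousAt

lemma arcLength_zero : arcLength α 0 = 0 := by simp [arcLength]

lemma arcLength_neg (θ : ℝ) : arcLength α (-θ) = -arcLength α θ := by
  unfold arcLength
  have := intervalIntegral.integral_comp_neg (a := 0) (b := θ)
    (fun x : ℝ => Real.cos x ^ (1 / α) / α)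
  rw [intervalIntegral.integral_symm]
  simpa using this.symm

lemma strictMonoOn_arcLength (h0 : 0 < α) :
    StrictMonoOn (arcLength α) (Icc (-(Real.pi / 2)) (Real.pi / 2)) := by
  refine strictMonoOn_of_deriv_pos (convex_Icc _ _)
    (fun x _ => (hasDerivAt_arcLength h0 x).continuousAt.continuousWithinAt) fun x hx => ?_
  rw [interior_Icc] at hx
  rw [(hasDerivAt_arcLength h0 x).deriv]
  have := Real.cos_pos_of_mem_Ioo hx
  positivity

lemma integral_rpow_mul_one_sub_rpow {s t : ℝ} (hs : 0 < s) (ht : 0 < t) :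
    ∫ x in (0 : ℝ)..1, x ^ (s - 1) * (1 - x) ^ (t - 1) =
      Real.Gamma s * Real.Gamma t / Real.Gamma (s + t) := by
  have h := ProbabilityTheory.beta_eq_betaIntegralReal s t hs ht
  rw [ProbabilityTheory.beta] at h
  rw [h, Complex.betaIntegral, ← Complex.ofReal_re (∫ x in (0 : ℝ)..1, _),
    ← intervalIntegral.integral_ofReal]
  congr 1
  refine intervalIntegral.integral_congr fun x hx => ?_
  rw [uIcc_of_le zero_le_one] at hx
  push_cast
  rw [Complex.ofReal_cpow hx.1, Complex.ofReal_cpow (sub_nonneg.2 hx.2)]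
  push_cast
  rfl

/-- The substitution u = sin² x turns the integral into a Beta integral. -/
lemma arcLength_pi_div_two (h0 : 0 < α) : arcLength α (Real.pi / 2) = Cα α := by
  have hpi : 0 ≤ Real.pi / 2 := by positivity
  -- The factor u^(−1/2) is singular at 0; the monotone change of variables requires no continuity
  -- of the integrand.
  have hsub := intervalIntegral.integral_comp_mul_deriv_of_deriv_nonneg (a := 0) (b := Real.pi / 2)
    (f := fun x => Real.sin x ^ 2) (f' := fun x => 2 * Real.sin x * Real.cos x)
    (g := fun u : ℝ => u ^ ((1 / 2 : ℝ) - 1) * (1 - u) ^ ((1 + α) / (2 * α) - 1))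
    (by fun_prop)
    (fun x _ => by simpa using (Real.hasDerivAt_sin x).fun_pow 2)
    (fun x hx => by
      rw [min_eq_left hpi, max_eq_right hpi] at hx
      have := Real.sin_pos_of_pos_of_lt_pi hx.1 (by linarith [hx.2, Real.pi_pos])
      have := Real.cos_pos_of_mem_Ioo ⟨by linarith [hx.1, Real.pi_pos], hx.2⟩
      positivity)
  simp only [Real.sin_zero, Real.sin_pi_div_two, one_pow, ne_eq, OfNat.ofNat_ne_zero,
    not_false_eq_true, zero_pow] at hsub
  rw [integral_rpow_mul_one_sub_rpow (by norm_num) (by positivity), Real.Gamma_one_half_eq] at hsub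
  have hcongr : ∫ x in (0 : ℝ)..Real.pi / 2, ((fun u : ℝ => u ^ ((1 / 2 : ℝ) - 1) *
      (1 - u) ^ ((1 + α) / (2 * α) - 1)) ∘ fun x => Real.sin x ^ 2) x *
        (2 * Real.sin x * Real.cos x) =
      ∫ x in (0 : ℝ)..Real.pi / 2, (2 * α) * (Real.cos x ^ (1 / α) / α) := by
    rw [intervalIntegral.integral_of_le hpi, intervalIntegral.integral_of_le hpi,
      MeasureTheory.integral_Ioc_eq_integral_Ioo, MeasureTheory.integral_Ioc_eq_integral_Ioo]
    refine MeasureTheory.setIntegral_congr_fun measurableSet_Ioo fun x hx => ?_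
    have hs := Real.sin_pos_of_pos_of_lt_pi hx.1 (by linarith [hx.2, Real.pi_pos])
    have hc := Real.cos_pos_of_mem_Ioo ⟨by linarith [hx.1, Real.pi_pos], hx.2⟩
    have e1 : (Real.sin x ^ 2) ^ ((1 / 2 : ℝ) - 1) = (Real.sin x)⁻¹ := by
      rw [← Real.rpow_natCast, ← Real.rpow_mul hs.le, ← Real.rpow_neg_one]
      norm_num
    have e2 : (1 - Real.sin x ^ 2) ^ ((1 + α) / (2 * α) - 1) * Real.cos x =
        Real.cos x ^ (1 / α) := by
      rw [← Real.cos_sq', ← Real.rpow_natCast, ← Real.rpow_mul hc.le, ← Real.rpow_add_one hc.ne']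
      congr 1
      push_cast
      field_simp
      ring
    simp only [Function.comp]
    rw [e1, ← e2]
    field_simp
  rw [hcongr, intervalIntegral.integral_const_mul] at hsub
  have e3 : 1 / 2 + (1 + α) / (2 * α) = 1 / (2 * α) + 1 := by field_simp; ring
  rw [e3, Real.Gamma_add_one (by positivity)] at hsub
  have hG : Real.Gamma (1 / (2 * α)) ≠ 0 := (Real.Gamma_pos_of_pos (by positivity)).ne'
  unfold arcLength Cα
  have h2 : (2 * α) ≠ 0 := by positivity
  apply mul_left_cancel₀ h2
  rw [hsub]
  field_simp

/-! ### F_α in the angular variable, and its inverse -/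

/-- `F_α` in the variable `θ` with `z = cos θ`. -/
noncomputable def angularF (α θ : ℝ) : ℝ :=
  Cα α - arcLength α θ + Real.cos θ ^ (1 / α - 1) * Real.sin θ

lemma continuous_angularF (h0 : 0 < α) (h1 : α < 1) : Continuous (angularF α) := by
  have hc : Continuous (arcLength α) :=
    continuous_iff_continuousAt.2 fun θ => (hasDerivAt_arcLength h0 θ).continuousAt
  have hp : 0 ≤ 1 / α - 1 := by rw [sub_nonneg, le_div_iff₀ h0]; linarith
  exact (continuous_const.sub hc).add
    ((Real.continuous_cos.rpow_const fun _ => Or.inr hp).mul Real.continuous_sin)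

lemma hasDerivAt_angularF (h0 : 0 < α) {θ : ℝ} (hθ : 0 < Real.cos θ) :
    HasDerivAt (angularF α) (-((1 - α) / α * Real.cos θ ^ (1 / α - 2))) θ := by
  have h := ((hasDerivAt_arcLength h0 θ).const_sub (Cα α)).add
    (((Real.hasDerivAt_cos θ).rpow_const (p := 1 / α - 1) (Or.inl hθ.ne')).mul
      (Real.hasDerivAt_sin θ))
  refine h.congr_deriv ?_
  have e1 : Real.cos θ ^ (1 / α) = Real.cos θ ^ (1 / α - 2) * Real.cos θ ^ 2 := by
    rw [← Real.rpow_add_natCast hθ.ne']; congr 1; push_cast; ring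
  have e2 : Real.cos θ ^ (1 / α - 1) = Real.cos θ ^ (1 / α - 2) * Real.cos θ := by
    rw [← Real.rpow_add_one hθ.ne']; congr 1; ring
  have e3 : Real.cos θ ^ (1 / α - 1 - 1) = Real.cos θ ^ (1 / α - 2) := by congr 1; ring
  rw [e3, e2, e1]
  field_simp
  linear_combination (α - 1) * Real.sin_sq_add_cos_sq θ

lemma strictAntiOn_angularF (h0 : 0 < α) (h1 : α < 1) :
    StrictAntiOn (angularF α) (Icc 0 (Real.pi / 2)) := by
  refine strictAntiOn_of_deriv_neg (convex_Icc _ _)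
    (continuous_angularF h0 h1).continuousOn fun x hx => ?_
  rw [interior_Icc] at hx
  have hc := Real.cos_pos_of_mem_Ioo ⟨by linarith [hx.1, Real.pi_pos], hx.2⟩
  rw [(hasDerivAt_angularF h0 hc).deriv, neg_lt_zero]
  exact mul_pos (div_pos (sub_pos.2 h1) h0) (Real.rpow_pos_of_pos hc _)

lemma angularF_zero : angularF α 0 = Cα α := by simp [angularF, arcLength_zero]

lemma angularF_pi_div_two (h0 : 0 < α) (h1 : α < 1) : angularF α (Real.pi / 2) = 0 := by
  have hp : 1 / α - 1 ≠ 0 := by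
    rw [ne_eq, sub_eq_zero, div_eq_one_iff_eq h0.ne']; exact h1.ne'
  simp [angularF, arcLength_pi_div_two h0, Real.zero_rpow (by simpa using hp : α⁻¹ - 1 ≠ 0)]

/-- Both sides have the same derivative on (0, π/2) and tend to 0 at π/2. -/
lemma Fα_cos (h0 : 0 < α) (h1 : α < 1) {θ : ℝ} (hθ : θ ∈ Ioo 0 (Real.pi / 2)) :
    Fα α (Real.cos θ) = angularF α θ := by
  have hd : ∀ x ∈ Ioo 0 (Real.pi / 2),
      HasDerivAt (fun y => Fα α (Real.cos y) - angularF α y) 0 x := by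
    intro x hx
    have hc := Real.cos_pos_of_mem_Ioo ⟨by linarith [hx.1, Real.pi_pos], hx.2⟩
    have hs := Real.sin_pos_of_pos_of_lt_pi hx.1 (by linarith [hx.2, Real.pi_pos])
    have hc1 : Real.cos x < 1 := by nlinarith [Real.sin_sq_add_cos_sq x]
    refine ((HasDerivAt.comp (h₂ := Fα α) x (hasDerivAt_Fα h0 h1 hc hc1)
      (Real.hasDerivAt_cos x)).sub (hasDerivAt_angularF h0 hc)).congr_deriv ?_
    rw [← Real.sin_sq, Real.sqrt_sq hs.le]
    field_simp
    ring
  obtain ⟨c, hc⟩ := isOpen_Ioo.exists_is_const_of_deriv_eq_zero isPreconnected_Ioo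
    (fun x hx => (hd x hx).differentiableAt.differentiableWithinAt) (fun x hx => (hd x hx).deriv)
  -- The constant is fixed at θ → π/2, the centre of the power series; at θ = 0 its argument would
  -- reach the boundary of the disc of convergence.
  have hlim : Tendsto (fun y => Fα α (Real.cos y) - angularF α y) (𝓝[<] (Real.pi / 2)) (𝓝 0) := by
    have h2 := (continuous_angularF h0 h1).tendsto (Real.pi / 2)
    rw [angularF_pi_div_two h0 h1] at h2
    have h3 := Real.continuous_cos.tendsto (Real.pi / 2)
    rw [Real.cos_pi_div_two] at h3
    have h4 := ((tendsto_Fα_zero h0 h1).comp h3).sub h2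
    rw [sub_zero] at h4
    exact h4.mono_left nhdsWithin_le_nhds
  have hpi : (0 : ℝ) < Real.pi / 2 := by positivity
  have hlim' : Tendsto (fun y => Fα α (Real.cos y) - angularF α y) (𝓝[<] (Real.pi / 2)) (𝓝 c) := by
    refine tendsto_const_nhds.congr' ?_
    filter_upwards [Ioo_mem_nhdsLT hpi] with y hy using (hc y hy).symm
  have h0c := tendsto_nhds_unique hlim hlim'
  have := hc θ hθ
  linarith

lemma injOn_Fα (h0 : 0 < α) (h1 : α < 1) : InjOn (Fα α) (Ioo 0 1) := by
  have key : ∀ z ∈ Ioo (0 : ℝ) 1, Real.arccos z ∈ Ioo 0 (Real.pi / 2) ∧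
      Fα α z = angularF α (Real.arccos z) := by
    intro z hz
    have hm : Real.arccos z ∈ Ioo 0 (Real.pi / 2) :=
      ⟨Real.arccos_pos.2 hz.2, Real.arccos_lt_pi_div_two.2 hz.1⟩
    refine ⟨hm, ?_⟩
    rw [← Fα_cos h0 h1 hm, Real.cos_arccos (by linarith [hz.1]) hz.2.le]
  intro x hx y hy hxy
  rw [(key x hx).2, (key y hy).2] at hxy
  have := (strictAntiOn_angularF h0 h1).injOn (Ioo_subset_Icc_self (key x hx).1)
    (Ioo_subset_Icc_self (key y hy).1) hxy
  exact Real.arccos_injOn ⟨by linarith [hx.1], hx.2.le⟩ ⟨by linarith [hy.1], hy.2.le⟩ this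

lemma Gα_eq (h0 : 0 < α) (h1 : α < 1) {θ v : ℝ} (hθ : θ ∈ Ioo 0 (Real.pi / 2))
    (hv : (1 - α) / α * v = arcLength α θ - Real.cos θ ^ (1 / α - 1) * Real.sin θ) :
    Gα α v = Real.cos θ ^ (1 / α) := by
  have hc := Real.cos_pos_of_mem_Ioo ⟨by linarith [hθ.1, Real.pi_pos], hθ.2⟩
  have hs := Real.sin_pos_of_pos_of_lt_pi hθ.1 (by linarith [hθ.2, Real.pi_pos])
  have hc1 : Real.cos θ < 1 := by nlinarith [Real.sin_sq_add_cos_sq θ]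
  have e : Cα α - (1 - α) / α * v = Fα α (Real.cos θ) := by
    rw [hv, Fα_cos h0 h1 hθ, angularF]; ring
  unfold Gα
  rw [e, (injOn_Fα h0 h1).leftInvOn_invFunOn ⟨hc, hc1⟩]

lemma hubble_bounds (h0 : 0 < α) (h1 : α < 1) {θ v : ℝ} (hθ : θ ∈ Ioo 0 (Real.pi / 2))
    (hv : (1 - α) / α * v = arcLength α θ - Real.cos θ ^ (1 / α - 1) * Real.sin θ) :
    0 < v ∧ v < α / (1 - α) * Cα α := by
  have hpi : (0 : ℝ) < Real.pi / 2 := by positivity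
  have hk : 0 < (1 - α) / α := div_pos (sub_pos.2 h1) h0
  have e : (1 - α) / α * v = Cα α - angularF α θ := by rw [hv, angularF]; ring
  have l1 := strictAntiOn_angularF h0 h1 (left_mem_Icc.2 hpi.le) (Ioo_subset_Icc_self hθ) hθ.1
  have l2 := strictAntiOn_angularF h0 h1 (Ioo_subset_Icc_self hθ) (right_mem_Icc.2 hpi.le) hθ.2
  rw [angularF_zero] at l1
  rw [angularF_pi_div_two h0 h1] at l2
  refine ⟨pos_of_mul_pos_right (by linarith : 0 < (1 - α) / α * v) hk.le, ?_⟩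
  refine lt_of_mul_lt_mul_left ?_ hk.le
  have : (1 - α) / α * (α / (1 - α) * Cα α) = Cα α := by
    have := sub_pos.2 h1; field_simp
  linarith

/-! ### The angle as a function of distance -/

/-- The inverse of `arcLength α` on `(-π/2, π/2)`. -/
noncomputable def arcAngle (α r : ℝ) : ℝ :=
  Function.invFunOn (arcLength α) (Ioo (-(Real.pi / 2)) (Real.pi / 2)) r

lemma arcAngle_arcLength (h0 : 0 < α) {θ : ℝ} (hθ : θ ∈ Ioo (-(Real.pi / 2)) (Real.pi / 2)) :
    arcAngle α (arcLength α θ) = θ :=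
  ((strictMonoOn_arcLength h0).mono Ioo_subset_Icc_self).injOn.leftInvOn_invFunOn hθ

lemma image_arcLength (h0 : 0 < α) :
    arcLength α '' Ioo (-(Real.pi / 2)) (Real.pi / 2) = Ioo (-Cα α) (Cα α) := by
  have hpi : -(Real.pi / 2) ≤ Real.pi / 2 := by linarith [Real.pi_pos]
  have hm := strictMonoOn_arcLength h0
  refine Subset.antisymm ?_ ?_
  · rintro _ ⟨θ, hθ, rfl⟩
    have l1 := hm (left_mem_Icc.2 hpi) (Ioo_subset_Icc_self hθ) hθ.1
    have l2 := hm (Ioo_subset_Icc_self hθ) (right_mem_Icc.2 hpi) hθ.2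
    rw [arcLength_neg] at l1
    rw [arcLength_pi_div_two h0] at l1 l2
    exact ⟨l1, l2⟩
  · have := intermediate_value_Ioo hpi (f := arcLength α)
      (fun x _ => (hasDerivAt_arcLength h0 x).continuousAt.continuousWithinAt)
    rwa [arcLength_neg, arcLength_pi_div_two h0] at this

lemma arcAngle_spec (h0 : 0 < α) {r : ℝ} (hr : r ∈ Ioo (-Cα α) (Cα α)) :
    arcAngle α r ∈ Ioo (-(Real.pi / 2)) (Real.pi / 2) ∧ arcLength α (arcAngle α r) = r := by
  rw [← image_arcLength h0] at hr
  exact ⟨Function.invFunOn_mem hr, Function.invFunOn_eq hr⟩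

lemma hasDerivAt_arcAngle (h0 : 0 < α) {r : ℝ} (hr : r ∈ Ioo (-Cα α) (Cα α)) :
    HasDerivAt (arcAngle α) (α * Real.cos (arcAngle α r) ^ (-(1 / α))) r := by
  have hs := arcAngle_spec h0 hr
  have hc := Real.cos_pos_of_mem_Ioo hs.1
  have hmono : StrictMonoOn (arcAngle α) (Ioo (-Cα α) (Cα α)) := by
    intro x hx y hy hxy
    have h1 := arcAngle_spec h0 hx
    have h2 := arcAngle_spec h0 hy
    rw [← (strictMonoOn_arcLength h0).lt_iff_lt (Ioo_subset_Icc_self h1.1)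
      (Ioo_subset_Icc_self h2.1), h1.2, h2.2]
    exact hxy
  have himg : Ioo (-(Real.pi / 2)) (Real.pi / 2) ⊆ arcAngle α '' Ioo (-Cα α) (Cα α) := by
    intro θ hθ
    exact ⟨arcLength α θ, image_arcLength h0 ▸ mem_image_of_mem _ hθ, arcAngle_arcLength h0 hθ⟩
  have hcont : ContinuousAt (arcAngle α) r :=
    hmono.continuousAt_of_image_mem_nhds (Ioo_mem_nhds hr.1 hr.2)
      (mem_of_superset (Ioo_mem_nhds hs.1.1 hs.1.2) himg)
  refine (HasDerivAt.of_local_left_inverse hcont (hasDerivAt_arcLength h0 _) (by positivity)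
    ?_).congr_deriv ?_
  · filter_upwards [Ioo_mem_nhds hr.1 hr.2] with y hy using (arcAngle_spec h0 hy).2
  · rw [Real.rpow_neg hc.le, inv_div, div_eq_mul_inv]

lemma arcAngle_zero (h0 : 0 < α) : arcAngle α 0 = 0 := by
  have := arcAngle_arcLength h0 (θ := 0) ⟨by linarith [Real.pi_pos], by positivity⟩
  rwa [arcLength_zero] at this

lemma arcAngle_pos (h0 : 0 < α) {r : ℝ} (hr0 : 0 < r) (hr : r < Cα α) : 0 < arcAngle α r := by
  have hs := arcAngle_spec h0 (r := r) ⟨by linarith, hr⟩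
  rw [← (strictMonoOn_arcLength h0).lt_iff_lt ⟨by linarith [Real.pi_pos], by positivity⟩
    (Ioo_subset_Icc_self hs.1), hs.2, arcLength_zero]
  exact hr0

/-! ### The geodesic equation and its closed-form solution -/

lemma geodesic_acceleration {x : Vec} (hx : 0 < x 0) (w : Vec) :
    (fun i => -∑ j, ∑ k, christoffel (rwMetric fun t : ℝ => t ^ α) x i j k * w j * w k) =
      ![-(α * (x 0 ^ α) ^ 2 / x 0 * w 1 ^ 2), -(2 * α / x 0 * w 0 * w 1)] := by
  have hA : 0 < x 0 ^ α := Real.rpow_pos_of_pos hx _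
  have hderiv : HasFDerivAt (fun y : Vec => (y 0 ^ α) ^ 2)
      ((2 * (α * (x 0 ^ α) ^ 2 / x 0)) •
        (ContinuousLinearMap.proj (R := ℝ) (φ := fun _ : Fin 2 => ℝ) 0)) x := by
    have h1 : HasDerivAt (fun t : ℝ => (t ^ α) ^ 2) (2 * (α * (x 0 ^ α) ^ 2 / x 0)) (x 0) := by
      refine ((Real.hasDerivAt_rpow_const (p := α) (Or.inl hx.ne')).fun_pow 2).congr_deriv ?_
      rw [Real.rpow_sub_one hx.ne']
      push_cast
      ring
    exact h1.comp_hasFDerivAt (f := fun y : Vec => y 0) x (hasFDerivAt_apply (𝕜 := ℝ) 0 x)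
  have hm : ∀ l, metricDeriv (rwMetric fun t : ℝ => t ^ α) x l 1 1 =
      if l = 0 then 2 * (α * (x 0 ^ α) ^ 2 / x 0) else 0 := by
    intro l
    have : (fun y => rwMetric (fun t : ℝ => t ^ α) y 1 1) = fun y : Vec => (y 0 ^ α) ^ 2 := by
      ext y; simp [rwMetric]
    rw [metricDeriv, this, hderiv.fderiv]
    fin_cases l <;> simp
  have hm' : ∀ l j k, (j = 0 ∨ k = 0) →
      metricDeriv (rwMetric fun t : ℝ => t ^ α) x l j k = 0 := by
    intro l j k hjk
    have : ∃ c : ℝ, (fun y => rwMetric (fun t : ℝ => t ^ α) y j k) = fun _ => c := by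
      fin_cases j <;> fin_cases k
      · exact ⟨-1, by ext y; simp [rwMetric]⟩
      · exact ⟨0, by ext y; simp [rwMetric]⟩
      · exact ⟨0, by ext y; simp [rwMetric]⟩
      · simp at hjk
    obtain ⟨c, hc⟩ := this
    rw [metricDeriv, hc]
    simp
  have hinv : (rwMetric (fun t : ℝ => t ^ α) x)⁻¹ = !![-1, 0; 0, ((x 0 ^ α) ^ 2)⁻¹] := by
    apply Matrix.inv_eq_left_inv
    ext i j
    fin_cases i <;> fin_cases j <;> simp [rwMetric, Matrix.mul_apply, Fin.sum_univ_two, hA.ne']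
  ext i
  fin_cases i
  · simp [christoffel, Fin.sum_univ_two, hinv, hm, hm']
    ring
  · simp [christoffel, Fin.sum_univ_two, hinv, hm, hm']
    field_simp
    ring

/-- Normalized coordinate time `t / τ` along the orthogonal geodesic, at distance `r τ`. -/
noncomputable def timeProfile (α r : ℝ) : ℝ := Real.cos (arcAngle α r) ^ (1 / α)

/-- Normalized spatial coordinate `χ / τ^(1-α)` along the orthogonal geodesic, at distance `r τ`. -/
noncomputable def spaceProfile (α r : ℝ) : ℝ :=
  (r - timeProfile α r * Real.tan (arcAngle α r)) / (1 - α)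

lemma cos_arcAngle_pos (h0 : 0 < α) {r : ℝ} (hr : r ∈ Ioo (-Cα α) (Cα α)) :
    0 < Real.cos (arcAngle α r) :=
  Real.cos_pos_of_mem_Ioo (arcAngle_spec h0 hr).1

lemma timeProfile_pos (h0 : 0 < α) {r : ℝ} (hr : r ∈ Ioo (-Cα α) (Cα α)) :
    0 < timeProfile α r :=
  Real.rpow_pos_of_pos (cos_arcAngle_pos h0 hr) _

lemma timeProfile_rpow (h0 : 0 < α) {r : ℝ} (hr : r ∈ Ioo (-Cα α) (Cα α)) :
    timeProfile α r ^ α = Real.cos (arcAngle α r) := by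
  rw [timeProfile, ← Real.rpow_mul (cos_arcAngle_pos h0 hr).le, one_div_mul_cancel h0.ne',
    Real.rpow_one]

lemma hasDerivAt_arcAngle_timeProfile (h0 : 0 < α) {r : ℝ} (hr : r ∈ Ioo (-Cα α) (Cα α)) :
    HasDerivAt (arcAngle α) (α / timeProfile α r) r := by
  refine (hasDerivAt_arcAngle h0 hr).congr_deriv ?_
  rw [timeProfile, Real.rpow_neg (cos_arcAngle_pos h0 hr).le]
  exact (div_eq_mul_inv _ _).symm

lemma hasDerivAt_timeProfile (h0 : 0 < α) {r : ℝ} (hr : r ∈ Ioo (-Cα α) (Cα α)) :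
    HasDerivAt (timeProfile α) (-Real.tan (arcAngle α r)) r := by
  have hc := cos_arcAngle_pos h0 hr
  have hf := timeProfile_pos h0 hr
  have h := (hasDerivAt_arcAngle_timeProfile h0 hr).cos.rpow_const (p := 1 / α) (Or.inl hc.ne')
  refine h.congr_deriv ?_
  rw [Real.rpow_sub_one hc.ne', ← timeProfile, Real.tan_eq_sin_div_cos]
  field_simp

lemma hasDerivAt_tan_arcAngle (h0 : 0 < α) {r : ℝ} (hr : r ∈ Ioo (-Cα α) (Cα α)) :
    HasDerivAt (fun r => Real.tan (arcAngle α r))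
      (α / (Real.cos (arcAngle α r) ^ 2 * timeProfile α r)) r := by
  have hc := cos_arcAngle_pos h0 hr
  have hf := timeProfile_pos h0 hr
  refine (HasDerivAt.comp (h₂ := Real.tan) r (Real.hasDerivAt_tan hc.ne')
    (hasDerivAt_arcAngle_timeProfile h0 hr)).congr_deriv ?_
  field_simp

/-- The numerator has derivative 1 + tan² θ − α/cos² θ = (1−α)/cos² θ. -/
lemma hasDerivAt_spaceProfile (h0 : 0 < α) (h1 : α < 1) {r : ℝ} (hr : r ∈ Ioo (-Cα α) (Cα α)) :
    HasDerivAt (spaceProfile α) (1 / Real.cos (arcAngle α r) ^ 2) r := by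
  have hc := cos_arcAngle_pos h0 hr
  have hf := timeProfile_pos h0 hr
  have h := (((hasDerivAt_id r).sub ((hasDerivAt_timeProfile h0 hr).mul
    (hasDerivAt_tan_arcAngle h0 hr))).div_const (1 - α))
  refine h.congr_deriv ?_
  have : 1 - α ≠ 0 := (sub_pos.2 h1).ne'
  rw [Real.tan_eq_sin_div_cos]
  field_simp
  linear_combination Real.sin_sq_add_cos_sq (arcAngle α r)

/-- Fermi coordinates to curvature-normalized coordinates, in closed form. -/
noncomputable def fermiFormula (α : ℝ) (y : Vec) : Vec :=
  ![y 0 * timeProfile α (y 1 / y 0), y 0 ^ (1 - α) * spaceProfile α (y 1 / y 0)]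

lemma isExp_fermiFormula (h0 : 0 < α) (h1 : α < 1) {τ ρ : ℝ} (hτ : 0 < τ) (hρ : 0 < ρ)
    (hC : ρ < Cα α * τ) :
    IsExp (rwMetric fun t : ℝ => t ^ α) spacetime (observer τ)
      (ρ • outward (fun t : ℝ => t ^ α) τ) (fermiFormula α ![τ, ρ]) := by
  have hT : 0 < τ ^ α := Real.rpow_pos_of_pos hτ _
  have hC' : 1 < Cα α * τ / ρ := (one_lt_div hρ).2 hC
  -- The solution lives for |s| < C_α τ/ρ; ε is half the margin beyond s = 1. Negative s are needed
  -- too, hence the angles in (−π/2, 0).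
  have hmem : ∀ s ∈ Ioo (-((Cα α * τ / ρ - 1) / 2)) (1 + (Cα α * τ / ρ - 1) / 2),
      ρ / τ * s ∈ Ioo (-Cα α) (Cα α) := by
    intro s hs
    have e : Cα α = ρ / τ * (Cα α * τ / ρ) := by field_simp
    have hp : 0 < ρ / τ := by positivity
    constructor
    · rw [e, ← mul_neg]; exact mul_lt_mul_of_pos_left (by linarith [hs.1]) hp
    · conv_rhs => rw [e]
      exact mul_lt_mul_of_pos_left (by linarith [hs.2]) hp
  have hsub : τ ^ (1 - α) = τ / τ ^ α := by rw [Real.rpow_sub hτ, Real.rpow_one]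
  refine ⟨fun s => ![τ * timeProfile α (ρ / τ * s), τ ^ (1 - α) * spaceProfile α (ρ / τ * s)],
    fun s => ![-(ρ * Real.tan (arcAngle α (ρ / τ * s))),
      ρ / τ ^ α * (1 / Real.cos (arcAngle α (ρ / τ * s)) ^ 2)],
    (Cα α * τ / ρ - 1) / 2, by linarith, ⟨?_, ?_, ?_⟩, ?_, ?_, ?_⟩
  · intro s hs
    have := timeProfile_pos h0 (hmem s hs)
    simp only [spacetime, mem_ofPred_eq, Matrix.cons_val_zero]
    positivity
  · intro s hs
    have hl : HasDerivAt (fun s : ℝ => ρ / τ * s) (ρ / τ) s := by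
      simpa using (hasDerivAt_id s).const_mul (ρ / τ)
    rw [hasDerivAt_pi]
    intro i
    fin_cases i
    · refine (((hasDerivAt_timeProfile h0 (hmem s hs)).comp s hl).const_mul τ).congr_deriv ?_
      simp
      field_simp
    · refine (((hasDerivAt_spaceProfile h0 h1 (hmem s hs)).comp s hl).const_mul
        (τ ^ (1 - α))).congr_deriv ?_
      simp [hsub]
      field_simp
  · intro s hs
    have hc := cos_arcAngle_pos h0 (hmem s hs)
    have hf := timeProfile_pos h0 (hmem s hs)
    have hl : HasDerivAt (fun s : ℝ => ρ / τ * s) (ρ / τ) s := by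
      simpa using (hasDerivAt_id s).const_mul (ρ / τ)
    rw [geodesic_acceleration (by simpa using mul_pos hτ hf)]
    rw [hasDerivAt_pi]
    intro i
    fin_cases i
    · refine (((hasDerivAt_tan_arcAngle h0 (hmem s hs)).comp s hl).const_mul ρ).neg.congr_deriv ?_
      simp only [Fin.zero_eta, Matrix.cons_val_zero, Matrix.cons_val_one]
      rw [Real.mul_rpow hτ.le hf.le, timeProfile_rpow h0 (hmem s hs)]
      field_simp
    · have h2 := ((((hasDerivAt_arcAngle_timeProfile h0 (hmem s hs)).comp s hl).cos.fun_pow 2).inv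
        (pow_pos hc 2).ne').const_mul (ρ / τ ^ α)
      simp only [Fin.mk_one, Matrix.cons_val_zero, Matrix.cons_val_one, one_div]
      refine h2.congr_deriv ?_
      rw [Real.tan_eq_sin_div_cos]
      simp only [Function.comp]
      generalize arcAngle α (ρ / τ * s) = θ at hc
      generalize timeProfile α (ρ / τ * s) = f at hf
      field_simp
      norm_num
      ring
  · simp [timeProfile, spaceProfile, arcAngle_zero h0, observer]
  · ext i
    fin_cases i
    · simp [arcAngle_zero h0, outward]
    · simp [arcAngle_zero h0, outward, div_eq_mul_inv]
  · simp [fermiFormula]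

/-! ### Uniqueness from first integrals -/

lemma eq_of_hasDerivAt_zero {ε : ℝ} (hε : 0 < ε) {f : ℝ → ℝ}
    (hf : ∀ s ∈ Ioo (-ε) (1 + ε), HasDerivAt f 0 s) :
    ∀ s ∈ Ioo (-ε) (1 + ε), f s = f 0 := fun _ hs =>
  isOpen_Ioo.is_const_of_deriv_eq_zero isPreconnected_Ioo
    (fun x hx => (hf x hx).differentiableAt.differentiableWithinAt) (fun x hx => (hf x hx).deriv)
    hs ⟨by linarith, by linarith⟩

/-- Four first integrals determine any such geodesic, so no uniqueness theorem for differential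
equations is needed. The bound on ρ holds because an arctangent stays strictly below π/2. -/
lemma isExp_unique (h0 : 0 < α) (h1 : α < 1) {τ ρ : ℝ} (hτ : 0 < τ) (hρ : 0 < ρ) {Q : Vec}
    (h : IsExp (rwMetric fun t : ℝ => t ^ α) spacetime (observer τ)
      (ρ • outward (fun t : ℝ => t ^ α) τ) Q) :
    ρ < Cα α * τ ∧ Q = fermiFormula α ![τ, ρ] := by
  obtain ⟨γ, w, ε, hε, ⟨hmem, hpos, hvel⟩, hγ0, hw0, hγ1⟩ := h
  have hT : 0 < τ ^ α := Real.rpow_pos_of_pos hτ _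
  have m0 : (0 : ℝ) ∈ Ioo (-ε) (1 + ε) := ⟨by linarith, by linarith⟩
  have m1 : (1 : ℝ) ∈ Ioo (-ε) (1 + ε) := ⟨by linarith, by linarith⟩
  have ht : ∀ s ∈ Ioo (-ε) (1 + ε), 0 < γ s 0 := hmem
  have hA : ∀ s ∈ Ioo (-ε) (1 + ε), 0 < γ s 0 ^ α := fun s hs => Real.rpow_pos_of_pos (ht s hs) _
  have dt : ∀ s ∈ Ioo (-ε) (1 + ε), HasDerivAt (fun s => γ s 0) (w s 0) s :=
    fun s hs => hasDerivAt_pi.1 (hpos s hs) 0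
  have dχ : ∀ s ∈ Ioo (-ε) (1 + ε), HasDerivAt (fun s => γ s 1) (w s 1) s :=
    fun s hs => hasDerivAt_pi.1 (hpos s hs) 1
  have dp : ∀ s ∈ Ioo (-ε) (1 + ε), HasDerivAt (fun s => w s 0)
      (-(α * (γ s 0 ^ α) ^ 2 / γ s 0 * w s 1 ^ 2)) s := fun s hs => by
    have := hvel s hs
    rw [geodesic_acceleration (ht s hs)] at this
    simpa using hasDerivAt_pi.1 this 0
  have dq : ∀ s ∈ Ioo (-ε) (1 + ε), HasDerivAt (fun s => w s 1)
      (-(2 * α / γ s 0 * w s 0 * w s 1)) s := fun s hs => by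
    have := hvel s hs
    rw [geodesic_acceleration (ht s hs)] at this
    simpa using hasDerivAt_pi.1 this 1
  have dA : ∀ s ∈ Ioo (-ε) (1 + ε), HasDerivAt (fun s => (γ s 0 ^ α) ^ 2)
      (2 * α * (γ s 0 ^ α) ^ 2 / γ s 0 * w s 0) s := fun s hs => by
    refine (((dt s hs).rpow_const (p := α) (Or.inl (ht s hs).ne')).fun_pow 2).congr_deriv ?_
    rw [Real.rpow_sub_one (ht s hs).ne']
    push_cast
    ring
  have i0 : γ 0 0 = τ := by simp [hγ0, observer]
  have i1 : γ 0 1 = 0 := by simp [hγ0, observer]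
  have i2 : w 0 0 = 0 := by simp [hw0, outward]
  have i3 : w 0 1 = ρ / τ ^ α := by simp [hw0, outward, div_eq_mul_inv]
  have momentum : ∀ s ∈ Ioo (-ε) (1 + ε), (γ s 0 ^ α) ^ 2 * w s 1 = ρ * τ ^ α := fun s hs => by
    refine (eq_of_hasDerivAt_zero hε (f := fun s => (γ s 0 ^ α) ^ 2 * w s 1)
      (fun s hs => ?_) s hs).trans ?_
    · refine ((dA s hs).mul (dq s hs)).congr_deriv ?_
      have := ht s hs
      field_simp
      ring
    · simp only [i0, i3]
      field_simp
  have norm : ∀ s ∈ Ioo (-ε) (1 + ε), (γ s 0 ^ α) ^ 2 * w s 1 ^ 2 - w s 0 ^ 2 = ρ ^ 2 :=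
    fun s hs => by
    refine (eq_of_hasDerivAt_zero hε (f := fun s => (γ s 0 ^ α) ^ 2 * w s 1 ^ 2 - w s 0 ^ 2)
      (fun s hs => ?_) s hs).trans ?_
    · refine (((dA s hs).mul ((dq s hs).fun_pow 2)).sub ((dp s hs).fun_pow 2)).congr_deriv ?_
      have := ht s hs
      push_cast
      field_simp
      ring
    · simp only [i0, i2, i3]
      field_simp
      ring
  have hcos : ∀ s ∈ Ioo (-ε) (1 + ε),
      Real.cos (Real.arctan (-(w s 0 / ρ))) = γ s 0 ^ α / τ ^ α := fun s hs => by
    have hq : 0 < w s 1 := pos_of_mul_pos_right (by rw [momentum s hs]; positivity)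
      (pow_pos (hA s hs) 2).le
    have hAs := hA s hs
    have e : 1 + (-(w s 0 / ρ)) ^ 2 = (γ s 0 ^ α * w s 1 / ρ) ^ 2 := by
      field_simp
      linear_combination -norm s hs
    rw [Real.cos_arctan, e, Real.sqrt_sq (by positivity)]
    field_simp
    linear_combination -momentum s hs
  have hcosr : ∀ s ∈ Ioo (-ε) (1 + ε),
      Real.cos (Real.arctan (-(w s 0 / ρ))) ^ (1 / α) = γ s 0 / τ := fun s hs => by
    rw [hcos s hs, ← Real.div_rpow (ht s hs).le hτ.le, ← Real.rpow_mul (div_pos (ht s hs) hτ).le,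
      mul_one_div_cancel h0.ne', Real.rpow_one]
  have hlen : ∀ s ∈ Ioo (-ε) (1 + ε),
      arcLength α (Real.arctan (-(w s 0 / ρ))) - ρ / τ * s = 0 := fun s hs => by
    refine (eq_of_hasDerivAt_zero hε
      (f := fun s => arcLength α (Real.arctan (-(w s 0 / ρ))) - ρ / τ * s)
      (fun s hs => ?_) s hs).trans ?_
    · have hl : HasDerivAt (fun s : ℝ => ρ / τ * s) (ρ / τ) s := by
        simpa using (hasDerivAt_id s).const_mul (ρ / τ)
      refine ((HasDerivAt.comp (h₂ := arcLength α) s (hasDerivAt_arcLength h0 _)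
        ((dp s hs).div_const ρ).neg.arctan).sub hl).congr_deriv ?_
      have hts := ht s hs
      have hn := norm s hs
      have hpos' : 0 < ρ ^ 2 + w s 0 ^ 2 := by positivity
      have hq2 : (γ s 0 ^ α) ^ 2 * w s 1 ^ 2 = ρ ^ 2 + w s 0 ^ 2 := by linarith
      have e : 1 + (-(w s 0 / ρ)) ^ 2 = (ρ ^ 2 + w s 0 ^ 2) / ρ ^ 2 := by field_simp
      have e2 : -(-(α * (γ s 0 ^ α) ^ 2 / γ s 0 * w s 1 ^ 2) / ρ) =
          α * (ρ ^ 2 + w s 0 ^ 2) / (γ s 0 * ρ) := by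
        rw [← hq2]; field_simp
      simp only [Pi.neg_apply]
      rw [hcosr s hs, e, e2]
      field_simp
      ring
    · simp [i2, arcLength_zero]
  -- By the geodesic equation and the norm, (t t')' = (1−α)a²χ'² − ρ²; conservation of momentum
  -- makes this integrable in closed form.
  have hχ : ∀ s ∈ Ioo (-ε) (1 + ε),
      (1 - α) * τ ^ α * γ s 1 - (ρ * s + γ s 0 * w s 0 / ρ) = 0 := fun s hs => by
    refine (eq_of_hasDerivAt_zero hε
      (f := fun s => (1 - α) * τ ^ α * γ s 1 - (ρ * s + γ s 0 * w s 0 / ρ))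
      (fun s hs => ?_) s hs).trans ?_
    · have hl : HasDerivAt (fun s : ℝ => ρ * s) ρ s := by
        simpa using (hasDerivAt_id s).const_mul ρ
      refine (((dχ s hs).const_mul ((1 - α) * τ ^ α)).sub
        (hl.add (((dt s hs).mul (dp s hs)).div_const ρ))).congr_deriv ?_
      have := ht s hs
      field_simp
      linear_combination norm s hs - (1 - α) * w s 1 * momentum s hs
    · simp [i1, i2]
  have hθm : Real.arctan (-(w 1 0 / ρ)) ∈ Ioo (-(Real.pi / 2)) (Real.pi / 2) :=
    Real.arctan_mem_Ioo _
  have hR : arcLength α (Real.arctan (-(w 1 0 / ρ))) = ρ / τ := by linarith [hlen 1 m1]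
  have hrC : ρ / τ < Cα α := by
    have : ρ / τ ∈ Ioo (-Cα α) (Cα α) := by
      rw [← image_arcLength h0, ← hR]; exact mem_image_of_mem _ hθm
    exact this.2
  have hang : arcAngle α (ρ / τ) = Real.arctan (-(w 1 0 / ρ)) := by
    rw [← hR, arcAngle_arcLength h0 hθm]
  have htp : timeProfile α (ρ / τ) = γ 1 0 / τ := by rw [timeProfile, hang, hcosr 1 m1]
  refine ⟨by rwa [div_lt_iff₀ hτ] at hrC, ?_⟩
  rw [← hγ1]
  ext i
  fin_cases i
  · simp [fermiFormula, htp]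
    field_simp
  · have hsub : τ ^ (1 - α) = τ / τ ^ α := by rw [Real.rpow_sub hτ, Real.rpow_one]
    have h1' : 1 - α ≠ 0 := (sub_pos.2 h1).ne'
    simp [fermiFormula, spaceProfile, htp, hang, Real.tan_arctan, hsub]
    have := hχ 1 m1
    field_simp
    field_simp at this
    linear_combination this

/-! ### The Fermi chart and its derivative -/

lemma mem_fermiDomain_iff (h0 : 0 < α) (h1 : α < 1) {τ ρ : ℝ} (hτ : 0 < τ) (hρ : 0 < ρ) :
    ![τ, ρ] ∈ fermiDomain (fun t : ℝ => t ^ α) ↔ ρ < Cα α * τ :=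
  ⟨fun ⟨_, _, h⟩ => (isExp_unique h0 h1 hτ hρ (by simpa using h)).1,
    fun h => ⟨by simpa using hτ, _, by simpa using isExp_fermiFormula h0 h1 hτ hρ h⟩⟩

lemma fermiMap_eq (h0 : 0 < α) (h1 : α < 1) {y : Vec} (hτ : 0 < y 0) (hρ : 0 < y 1)
    (hC : y 1 < Cα α * y 0) :
    fermiMap (fun t : ℝ => t ^ α) y = fermiFormula α y := by
  have hex : ∃ q, IsExp (rwMetric fun t : ℝ => t ^ α) spacetime (observer (y 0))
      (y 1 • outward (fun t : ℝ => t ^ α) (y 0)) q := ⟨_, isExp_fermiFormula h0 h1 hτ hρ hC⟩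
  -- `expMap` chooses some endpoint; uniqueness identifies the choice.
  rw [fermiMap, expMap, dif_pos hex, (isExp_unique h0 h1 hτ hρ hex.choose_spec).2]
  simp [fermiFormula]

lemma hasFDerivAt_ratio {y : Vec} (hy : 0 < y 0) :
    HasFDerivAt (fun y : Vec => y 1 / y 0)
      ((1 / y 0) • ContinuousLinearMap.proj (R := ℝ) (φ := fun _ : Fin 2 => ℝ) 1 -
        (y 1 / y 0 ^ 2) • ContinuousLinearMap.proj (R := ℝ) (φ := fun _ : Fin 2 => ℝ) 0) y := by
  refine ((hasFDerivAt_apply (𝕜 := ℝ) (F' := fun _ : Fin 2 => ℝ) 1 y).mul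
    ((hasDerivAt_inv hy.ne').comp_hasFDerivAt (f := fun y : Vec => y 0) y
      (hasFDerivAt_apply (𝕜 := ℝ) (F' := fun _ : Fin 2 => ℝ) 0 y))).congr_fderiv ?_
  refine ContinuousLinearMap.ext fun v => ?_
  simp
  field_simp
  ring

lemma hasFDerivAt_fermiFormula (h0 : 0 < α) (h1 : α < 1) {y : Vec} (hy : 0 < y 0)
    (hr : y 1 / y 0 ∈ Ioo (-Cα α) (Cα α)) :
    ∃ L : Vec →L[ℝ] Vec, HasFDerivAt (fermiFormula α) L y ∧
      L (Pi.single 0 1) =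
        ![timeProfile α (y 1 / y 0) + y 1 / y 0 * Real.tan (arcAngle α (y 1 / y 0)),
          y 0 ^ (-α) * ((1 - α) * spaceProfile α (y 1 / y 0) -
            y 1 / y 0 * (1 / Real.cos (arcAngle α (y 1 / y 0)) ^ 2))] ∧
      L (Pi.single 1 1) =
        ![-Real.tan (arcAngle α (y 1 / y 0)),
          y 0 ^ (-α) * (1 / Real.cos (arcAngle α (y 1 / y 0)) ^ 2)] := by
  have hp := hasFDerivAt_apply (𝕜 := ℝ) (F' := fun _ : Fin 2 => ℝ) 0 y
  have e : y 0 ^ (1 - α) = y 0 ^ (-α) * y 0 := by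
    rw [← Real.rpow_add_one hy.ne']; congr 1; ring
  obtain ⟨D0, d0, a0, b0⟩ : ∃ D : Vec →L[ℝ] ℝ,
      HasFDerivAt (fun y : Vec => y 0 * timeProfile α (y 1 / y 0)) D y ∧
      D (Pi.single 0 1) =
        timeProfile α (y 1 / y 0) + y 1 / y 0 * Real.tan (arcAngle α (y 1 / y 0)) ∧
      D (Pi.single 1 1) = -Real.tan (arcAngle α (y 1 / y 0)) := by
    have hf := (hasDerivAt_timeProfile h0 hr).comp_hasFDerivAt (f := fun y : Vec => y 1 / y 0) y
      (hasFDerivAt_ratio hy)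
    refine ⟨_, hp.mul hf, ?_, ?_⟩
    · simp
      field_simp
      ring
    · simp
      field_simp
  obtain ⟨D1, d1, a1, b1⟩ : ∃ D : Vec →L[ℝ] ℝ,
      HasFDerivAt (fun y : Vec => y 0 ^ (1 - α) * spaceProfile α (y 1 / y 0)) D y ∧
      D (Pi.single 0 1) = y 0 ^ (-α) * ((1 - α) * spaceProfile α (y 1 / y 0) -
            y 1 / y 0 * (1 / Real.cos (arcAngle α (y 1 / y 0)) ^ 2)) ∧
      D (Pi.single 1 1) = y 0 ^ (-α) * (1 / Real.cos (arcAngle α (y 1 / y 0)) ^ 2) := by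
    have hh := (hasDerivAt_spaceProfile h0 h1 hr).comp_hasFDerivAt (f := fun y : Vec => y 1 / y 0) y
      (hasFDerivAt_ratio hy)
    have ht := (Real.hasDerivAt_rpow_const (p := 1 - α) (Or.inl hy.ne')).comp_hasFDerivAt
      (f := fun y : Vec => y 0) y hp
    refine ⟨_, ht.mul hh, ?_, ?_⟩
    · simp [e]
      field_simp
      ring
    · simp [e]
      field_simp
  refine ⟨ContinuousLinearMap.pi fun i => ![D0, D1] i, ?_, ?_, ?_⟩
  · rw [hasFDerivAt_pi]
    exact Fin.forall_fin_two.2 ⟨d0, d1⟩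
  · ext i
    fin_cases i
    · exact a0
    · exact a1
  · ext i
    fin_cases i
    · exact b0
    · exact b1

end Fermi

/-! ### The metric in Fermi coordinates -/

open Fermi in
theorem corollary1 (α : ℝ) (hα0 : 0 < α) (hα1 : α < 1) (τ ρ : ℝ) (hτ : 0 < τ) (hρ : 0 < ρ) :
    (![τ, ρ] ∈ Fermi.fermiDomain (fun t : ℝ => t ^ α) ↔ ρ < Fermi.Cα α * τ) ∧
    (![τ, ρ] ∈ Fermi.fermiDomain (fun t : ℝ => t ^ α) →
      DifferentiableAt ℝ (Fermi.fermiMap (fun t : ℝ => t ^ α)) ![τ, ρ] ∧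
      (∃! χ : ℝ, Fermi.fermiMap (fun t : ℝ => t ^ α) ![τ, ρ] =
        ![Fermi.Gα α (Fermi.hubbleSpeed α τ χ) * τ, χ]) ∧
      ∀ χ v : ℝ, v = Fermi.hubbleSpeed α τ χ →
        Fermi.fermiMap (fun t : ℝ => t ^ α) ![τ, ρ] = ![Fermi.Gα α v * τ, χ] →
        0 < v ∧ v < α / (1 - α) * Fermi.Cα α ∧
        Fermi.fermiMetric (fun t : ℝ => t ^ α) ![τ, ρ] =
          !![-(Fermi.Gα α v ^ (1 - α)
              + (1 - α) / α * Real.sqrt (1 - Fermi.Gα α v ^ (2 * α)) * v) ^ 2, 0;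
            0, 1]) := by
  refine ⟨mem_fermiDomain_iff hα0 hα1 hτ hρ, fun hdom => ?_⟩
  have hC := (mem_fermiDomain_iff hα0 hα1 hτ hρ).1 hdom
  have hr0 : 0 < ρ / τ := div_pos hρ hτ
  have hrC : ρ / τ < Cα α := by rwa [div_lt_iff₀ hτ]
  have hr : ρ / τ ∈ Set.Ioo (-Cα α) (Cα α) := ⟨by linarith, hrC⟩
  have hmap : fermiMap (fun t : ℝ => t ^ α) ![τ, ρ] = fermiFormula α ![τ, ρ] :=
    fermiMap_eq hα0 hα1 (by simpa using hτ) (by simpa using hρ) (by simpa using hC)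
  -- The derivative needs the closed form on a neighbourhood, and the conditions for it are open.
  have hev : fermiMap (fun t : ℝ => t ^ α) =ᶠ[nhds ![τ, ρ]] fermiFormula α := by
    have c0 : Continuous fun y : Vec => y 0 := continuous_apply 0
    have c1 : Continuous fun y : Vec => y 1 := continuous_apply 1
    filter_upwards [(isOpen_lt continuous_const c0).mem_nhds (show (0 : ℝ) < ![τ, ρ] 0 by simpa),
      (isOpen_lt continuous_const c1).mem_nhds (show (0 : ℝ) < ![τ, ρ] 1 by simpa),
      (isOpen_lt c1 (c0.const_mul (Cα α))).mem_nhds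
        (show ![τ, ρ] 1 < Cα α * ![τ, ρ] 0 by simpa)] with y hy0 hy1 hy2
    exact fermiMap_eq hα0 hα1 hy0 hy1 hy2
  obtain ⟨L, hL, hL0, hL1⟩ := hasFDerivAt_fermiFormula hα0 hα1 (y := ![τ, ρ]) (by simpa)
    (by simpa using hr)
  have hL' := hL.congr_of_eventuallyEq hev
  have hs := (arcAngle_spec hα0 hr).2
  have hθ : arcAngle α (ρ / τ) ∈ Set.Ioo 0 (Real.pi / 2) :=
    ⟨arcAngle_pos hα0 hr0 hrC, (arcAngle_spec hα0 hr).1.2⟩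
  have hc := cos_arcAngle_pos hα0 hr
  have hf := timeProfile_pos hα0 hr
  have hfα := timeProfile_rpow hα0 hr
  have hsin := Real.sin_pos_of_pos_of_lt_pi hθ.1 (by linarith [hθ.2, Real.pi_pos])
  have h1' : 0 < 1 - α := sub_pos.2 hα1
  have hT : 0 < τ ^ α := Real.rpow_pos_of_pos hτ _
  have hspace : (1 - α) * spaceProfile α (ρ / τ) =
      ρ / τ - timeProfile α (ρ / τ) * Real.tan (arcAngle α (ρ / τ)) := by
    rw [spaceProfile]; field_simp
  have hv : (1 - α) / α * (α * spaceProfile α (ρ / τ)) = arcLength α (arcAngle α (ρ / τ)) -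
      Real.cos (arcAngle α (ρ / τ)) ^ (1 / α - 1) * Real.sin (arcAngle α (ρ / τ)) := by
    rw [hs, Real.rpow_sub_one hc.ne', ← timeProfile]
    have : (1 - α) / α * (α * spaceProfile α (ρ / τ)) = (1 - α) * spaceProfile α (ρ / τ) := by
      field_simp
    rw [this, hspace, Real.tan_eq_sin_div_cos]
    ring
  have hG : Gα α (α * spaceProfile α (ρ / τ)) = timeProfile α (ρ / τ) := Gα_eq hα0 hα1 hθ hv
  have hub : hubbleSpeed α τ (τ ^ (1 - α) * spaceProfile α (ρ / τ)) =
      α * spaceProfile α (ρ / τ) := by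
    have : 0 < τ ^ (1 - α) := Real.rpow_pos_of_pos hτ _
    rw [hubbleSpeed]; field_simp
  refine ⟨hL'.differentiableAt, ⟨τ ^ (1 - α) * spaceProfile α (ρ / τ), ?_, ?_⟩, ?_⟩
  · simp only [hub, hG, hmap, fermiFormula, Matrix.cons_val_zero, Matrix.cons_val_one, mul_comm τ]
  · intro χ hχ
    rw [hmap] at hχ
    have := congrFun hχ 1
    simpa [fermiFormula] using this.symm
  · intro χ v hvχ hχ
    have hχ' : χ = τ ^ (1 - α) * spaceProfile α (ρ / τ) := by
      rw [hmap] at hχ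
      have := congrFun hχ 1
      simpa [fermiFormula] using this.symm
    have hv' : v = α * spaceProfile α (ρ / τ) := by rw [hvχ, hχ', hub]
    obtain ⟨b1, b2⟩ := hubble_bounds hα0 hα1 hθ hv
    rw [hv', hG]
    refine ⟨b1, b2, ?_⟩
    have hx : (![τ, ρ] : Vec) 1 / (![τ, ρ] : Vec) 0 = ρ / τ := by simp
    rw [hx] at hL0 hL1
    have hτα : (![τ, ρ] : Vec) 0 ^ (-α) = (τ ^ α)⁻¹ := by simp [Real.rpow_neg hτ.le]
    rw [hτα] at hL0 hL1
    have hsq : Real.sqrt (1 - timeProfile α (ρ / τ) ^ (2 * α)) =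
        Real.sin (arcAngle α (ρ / τ)) := by
      rw [mul_comm 2 α, Real.rpow_mul hf.le, hfα, Real.rpow_two, ← Real.sin_sq,
        Real.sqrt_sq hsin.le]
    have hpow : timeProfile α (ρ / τ) ^ (1 - α) =
        timeProfile α (ρ / τ) / Real.cos (arcAngle α (ρ / τ)) := by
      rw [Real.rpow_sub hf, hfα, Real.rpow_one]
    have hscale : (fermiFormula α ![τ, ρ] 0) ^ α = τ ^ α * Real.cos (arcAngle α (ρ / τ)) := by
      simp only [fermiFormula, Matrix.cons_val_zero, Matrix.cons_val_one]
      rw [Real.mul_rpow hτ.le hf.le, hfα]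
    have hmul : (1 - α) / α * Real.sin (arcAngle α (ρ / τ)) * (α * spaceProfile α (ρ / τ)) =
        Real.sin (arcAngle α (ρ / τ)) * ((1 - α) * spaceProfile α (ρ / τ)) := by
      field_simp
    rw [fermiMetric, pullback, hL'.fderiv, hmap, hsq, hpow, hmul]
    rw [hspace] at hL0 ⊢
    rw [Real.tan_eq_sin_div_cos] at hL0 hL1 ⊢
    have hsc := Real.sin_sq_add_cos_sq (arcAngle α (ρ / τ))
    -- What remains is algebra in f, r, T, S, c with S² + c² = 1.
    generalize arcAngle α (ρ / τ) = θ at *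
    generalize timeProfile α (ρ / τ) = f at *
    generalize ρ / τ = r at *
    generalize τ ^ α = T at *
    have hss : Real.sin θ ^ 2 = 1 - Real.cos θ ^ 2 := by linarith
    generalize Real.sin θ = S at *
    generalize Real.cos θ = c at *
    ext i j
    fin_cases i <;> fin_cases j <;>
      simp [hL0, hL1, rwMetric, hscale, dotProduct, Matrix.mulVec, Fin.sum_univ_two]
    · field_simp
      -- In the orthonormal frame (∂_t, a⁻¹∂_χ), the τ-derivative is ((fc + rS)/c)·(1, −S) and the
      -- ρ-derivative is (−S, 1)/c; `e2` shows that the stated root of −g_ττ is fc + rS.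
      have e1 : c * (r * c - f * S) - r = -S * (f * c + r * S) := by linear_combination r * hsc
      have e2 : f + S * (r * c - f * S) = c * (f * c + r * S) := by linear_combination -f * hsc
      rw [e1, e2]
      linear_combination (f * c + r * S) ^ 2 * hsc
    · field_simp
      linear_combination r * hsc
    · field_simp
      linear_combination r * hsc
    · field_simp
      linear_combination -hsc
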